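/- Let $d$ be the Euclidean distance on $\mathbb R^2$. There exist a probability measure $\mu$ on $\mathbb R^2$ with $\mu(B)=1$, where $B$ is the closed unit ball centered at the origin, and centers $c_1,\dots,c_7\in\mathbb R^2$ such that (i) $\mu$ has a continuous density function with respect to Lebesgue measure; (ii) $\mu$ is invariant under rotations centered at the origin; (iii) every open set containing the origin has positive $\mu$-measure; (iv) $\min_{i\neq j} d(c_i,c_j)=2.2$; and such that with high probability the $k$-median linear program with $k=7$ does not achieve exact recovery in the stochastic ball model given by $\mu$ and $c_1,\dots,c_7$. The terms in the last clause mean the following. For $n\ge 1$ draw independent random vectors $v^{(i)}_\ell$, $i\in\{1,\dots,7\}$, $\ell\in\{1,\dots,n\}$, according to $\mu$, and let $P$ be the family of the $7n$ data points $x^{(i)}_\ell=c_i+v^{(i)}_\ell$ (almost surely distinct). The $k$-median linear program is $$\min \sum_{p,q\in P} d(p,q)z_{pq}\quad\text{s.t.}\quad \sum_{p\in P}z_{pq}=1\ \ \forall q\in P,\quad z_{pq}\le y_p\ \ \forall p,q\in P,\quad \sum_{p\in P}y_p=7,\quad y_p,z_{pq}\ge 0\ \ \forall p,q\in P.$$ It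 achieves exact recovery if it has a unique optimal solution $(y,z)$, all entries of this solution are in $\{0,1\}$, and $z_{pq}=1$ only if $p$ and $q$ are drawn from the same ball, i.e. $p=x^{(i)}_\ell$ and $q=x^{(i)}_{\ell'}$ for some $i,\ell,\ell'$. "With high probability" means that for every $\delta\in(0,1)$ there is $N$ such that for all $n>N$ the probability that exact recovery is not achieved is greater than $1-\delta$. -/

import Mathlib

open MeasureTheory

/-! The `k`-median problem on a finite family of points `x : ι → X`.
`y p` says how much `p` is opened as a center, `z p q` how much `q` is assigned to `p`. -/

namespace KMedian

/-- The objective function `∑_{p,q} d(p,q) z_{pq}`. -/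
noncomputable def cost {ι X : Type*} [Fintype ι] [MetricSpace X] (x : ι → X) (z : ι → ι → ℝ) : ℝ :=
  ∑ p, ∑ q, dist (x p) (x q) * z p q

/-- Feasibility for the linear programming relaxation (LP). -/
structure LPFeasible {ι : Type*} [Fintype ι] (k : ℕ) (y : ι → ℝ) (z : ι → ι → ℝ) : Prop where
  assigned : ∀ q, ∑ p, z p q = 1
  le_open : ∀ p q, z p q ≤ y p
  sum_open : ∑ p, y p = (k : ℝ)
  y_nonneg : ∀ p, 0 ≤ y p
  z_nonneg : ∀ p q, 0 ≤ z p q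

/-- Feasibility for the integer program (IP). -/
structure IPFeasible {ι : Type*} [Fintype ι] (k : ℕ) (y : ι → ℝ) (z : ι → ι → ℝ) : Prop where
  assigned : ∀ q, ∑ p, z p q = 1
  le_open : ∀ p q, z p q ≤ y p
  sum_open : ∑ p, y p = (k : ℝ)
  y_binary : ∀ p, y p = 0 ∨ y p = 1
  z_binary : ∀ p q, z p q = 0 ∨ z p q = 1

/-- `(y, z)` is an optimal solution to (LP). -/
def IsLPOptimal {ι X : Type*} [Fintype ι] [MetricSpace X] (k : ℕ) (x : ι → X)
    (y : ι → ℝ) (z : ι → ι → ℝ) : Prop :=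
  LPFeasible k y z ∧ ∀ y' z', LPFeasible k y' z' → cost x z ≤ cost x z'

/-- (LP) achieves exact recovery for the points `x (i, ℓ)`, where `x (i, ℓ)` is the `ℓ`-th point
drawn from ball `i`: it has a unique optimal solution, this solution is feasible to (IP), and it
assigns each point to a center that is drawn from the same ball. -/
def AchievesExactRecovery {X : Type*} [MetricSpace X] {k n : ℕ} (x : Fin k × Fin n → X) : Prop :=
  ∃ (y : Fin k × Fin n → ℝ) (z : Fin k × Fin n → Fin k × Fin n → ℝ),
    IsLPOptimal k x y z ∧
    (∀ y' z', IsLPOptimal k x y' z' → y' = y ∧ z' = z) ∧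
    IPFeasible k y z ∧
    ∀ p q, z p q = 1 → p.1 = q.1

end KMedian

/-! The stochastic ball model in `ℝ^m`. -/

namespace SBM

/-- `μ` is a probability measure living on the closed unit ball centered at the origin. -/
structure IsUnitBallProbability {m : ℕ} (μ : Measure (EuclideanSpace ℝ (Fin m))) : Prop where
  isProbability : IsProbabilityMeasure μ
  supported : μ (Metric.closedBall 0 1)ᶜ = 0

/-- The joint law of the `k * n` independent random vectors `v (i, ℓ)`, each drawn according
to `μ`. -/
noncomputable def sampleLaw {m : ℕ} (μ : Measure (EuclideanSpace ℝ (Fin m))) (k n : ℕ) :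
    Measure (Fin k × Fin n → EuclideanSpace ℝ (Fin m)) :=
  Measure.pi fun _ => μ

/-- The data points `c i + v (i, ℓ)`. -/
noncomputable def dataPoints {m k n : ℕ} (c : Fin k → EuclideanSpace ℝ (Fin m))
    (v : Fin k × Fin n → EuclideanSpace ℝ (Fin m)) :
    Fin k × Fin n → EuclideanSpace ℝ (Fin m) :=
  fun p => c p.1 + v p

/-- Invariance under rotations centered at the origin. All linear isometries are allowed (for
`m = 1` this is symmetry; for `m ≥ 2` it is equivalent to invariance under those of
determinant one). -/
def IsRotationInvariant {m : ℕ} (μ : Measure (EuclideanSpace ℝ (Fin m))) : Prop :=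
  ∀ A : EuclideanSpace ℝ (Fin m) ≃ₗᵢ[ℝ] EuclideanSpace ℝ (Fin m), μ.map A = μ

/-- Every open set containing the origin has positive measure. -/
def HasMassNearCenter {m : ℕ} (μ : Measure (EuclideanSpace ℝ (Fin m))) : Prop :=
  ∀ U : Set (EuclideanSpace ℝ (Fin m)), IsOpen U → 0 ∈ U → 0 < μ U

/-- `μ` has a continuous density function with respect to Lebesgue measure on `ℝ^m`. -/
def HasContinuousDensity {m : ℕ} (μ : Measure (EuclideanSpace ℝ (Fin m))) : Prop :=
  ∃ f : EuclideanSpace ℝ (Fin m) → ℝ, Continuous f ∧ (∀ x, 0 ≤ f x) ∧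
    μ = volume.withDensity fun x => ENNReal.ofReal (f x)

/-- The events `A n` happen with high probability: for every `δ ∈ (0,1)`, for all large `n`,
`Pr (A n) > 1 - δ`. The measurable set `E` makes this an inner-measure bound, so that it says
`Pr (A n) > 1 - δ` for measurable `A n` and is never weaker than that. -/
def WithHighProbability {Ω : ℕ → Type*} [∀ n, MeasurableSpace (Ω n)] (P : ∀ n, Measure (Ω n))
    (A : ∀ n, Set (Ω n)) : Prop :=
  ∀ δ : ℝ, 0 < δ → δ < 1 → ∃ N : ℕ, ∀ n : ℕ, N < n →
    ∃ E : Set (Ω n), MeasurableSet E ∧ E ⊆ A n ∧ ENNReal.ofReal (1 - δ) < P n E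

end SBM

/-! Let the mass of `μ` concentrate near the unit circle: the radial density is proportional to `r ^
1000 * (1 - r)`, continuous at the boundary and positive near, though not at, the origin. One median
per ball then costs about `1` per point, since no position in a ball does noticeably better than its
center. On the grid with spacing `2.2` it is cheaper to leave the middle ball without a median. Its
right neighbor receives two medians, at `±4/5` on the horizontal axis, while the medians of its
other three neighbors move inward by `6/25`. The middle ball now costs about `1.03` per point, the
ball with two medians about `0.79`, each ball with a shifted median about `1.03`, the two corner
balls about `1`. The total is about `6.91`, against `7 * 501/502` for exact recovery.

Exact recovery forces one open center per ball and makes the LP optimum at most the cost of any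
assignment to seven distinct data points (`exists_centers`). Upper bounds that are affine in
coordinates, or in maxima of their absolute values, reduce the expected competing cost to first
moments (`sum_integral_serviceBound_lt`). The direction sums bound the recovery cost below,
uniformly in the chosen centers (`sum_norm_sub_le_sum_dist`). The law of large numbers transfers the
strict gap to the sample. -/

namespace SBM

open ProbabilityTheory

/-! ### High-probability events and the weak law of large numbers -/

section HighProbability

variable {Ω : ℕ → Type*} [∀ n, MeasurableSpace (Ω n)] {P : ∀ n, Measure (Ω n)}

theorem WithHighProbability.mono {A B : ∀ n, Set (Ω n)} (hA : WithHighProbability P A)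
    (hAB : ∃ N, ∀ n, N < n → A n ⊆ B n) : WithHighProbability P B := by
  obtain ⟨M, hM⟩ := hAB
  intro δ h0 h1
  obtain ⟨N, hN⟩ := hA δ h0 h1
  refine ⟨max N M, fun n hn => ?_⟩
  obtain ⟨E, hE, hEA, hP⟩ := hN n (lt_of_le_of_lt (le_max_left _ _) hn)
  exact ⟨E, hE, hEA.trans (hM n (lt_of_le_of_lt (le_max_right _ _) hn)), hP⟩

/-- A high-probability statement follows from bounds on the probability of complements. -/
theorem WithHighProbability.of_compl_le [∀ n, IsProbabilityMeasure (P n)] {A : ∀ n, Set (Ω n)}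
    (hA : ∀ n, MeasurableSet (A n))
    (h : ∀ δ : ℝ, 0 < δ → ∃ N, ∀ n, N < n → (P n).real (A n)ᶜ < δ) :
    WithHighProbability P A := by
  intro δ h0 h1
  obtain ⟨N, hN⟩ := h δ h0
  refine ⟨N, fun n hn => ⟨A n, hA n, subset_rfl, ?_⟩⟩
  have h2 := hN n hn
  rw [probReal_compl_eq_one_sub (hA n)] at h2
  rw [ENNReal.ofReal_lt_iff_lt_toReal (by linarith) (measure_ne_top _ _)]
  change 1 - δ < (P n).real (A n)
  linarith

theorem WithHighProbability.iInter [∀ n, IsProbabilityMeasure (P n)] {κ : Type*} [Fintype κ]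
    {A : κ → ∀ n, Set (Ω n)} (h : ∀ j, WithHighProbability P (A j)) :
    WithHighProbability P fun n => ⋂ j, A j n := by
  intro δ h0 h1
  -- The extra `1` makes the union bound strict and covers an empty index type.
  set c : ℝ := Fintype.card κ + 1 with hc
  have hcpos : 0 < c := by positivity
  have hδc : δ / c < 1 := by
    rw [div_lt_one hcpos]
    have : (0 : ℝ) ≤ Fintype.card κ := by positivity
    linarith
  have hδ0 : 0 < δ / c := by positivity
  choose N hN using fun j => h j (δ / c) hδ0 hδc
  refine ⟨Finset.univ.sup N, fun n hn => ?_⟩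
  choose E hE hEA hP using fun j => hN j n
    (lt_of_le_of_lt (Finset.le_sup (Finset.mem_univ j)) hn)
  refine ⟨⋂ j, E j, MeasurableSet.iInter hE, Set.iInter_mono hEA, ?_⟩
  have hsmall : ∀ j, (P n).real (E j)ᶜ ≤ δ / c := by
    intro j
    have h2 := hP j
    rw [ENNReal.ofReal_lt_iff_lt_toReal (by linarith) (measure_ne_top _ _)] at h2
    change 1 - δ / c < (P n).real (E j) at h2
    rw [probReal_compl_eq_one_sub (hE j)]
    linarith
  have hcompl : (P n).real (⋂ j, E j)ᶜ < δ := by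
    rw [Set.compl_iInter]
    calc (P n).real (⋃ j, (E j)ᶜ) ≤ ∑ j, (P n).real (E j)ᶜ := measureReal_iUnion_fintype_le _
      _ ≤ ∑ _j : κ, δ / c := Finset.sum_le_sum fun j _ => hsmall j
      _ = Fintype.card κ * (δ / c) := by simp
      _ < c * (δ / c) := by
        apply mul_lt_mul_of_pos_right _ hδ0
        linarith
      _ = δ := by field_simp
  rw [probReal_compl_eq_one_sub (MeasurableSet.iInter hE)] at hcompl
  rw [ENNReal.ofReal_lt_iff_lt_toReal (by linarith) (measure_ne_top _ _)]
  change 1 - δ < (P n).real _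
  linarith

theorem WithHighProbability.inter [∀ n, IsProbabilityMeasure (P n)] {A B : ∀ n, Set (Ω n)}
    (hA : WithHighProbability P A) (hB : WithHighProbability P B) :
    WithHighProbability P fun n => A n ∩ B n := by
  have h := WithHighProbability.iInter (P := P) (κ := Bool)
    (A := fun b n => bif b then A n else B n) (by rintro (_ | _) <;> simpa)
  refine h.mono ⟨0, fun n _ v hv => ?_⟩
  simp only [Set.mem_iInter, Bool.forall_bool, cond_false, cond_true] at hv
  exact ⟨hv.2, hv.1⟩

end HighProbability

variable {m k : ℕ} {μ : Measure (EuclideanSpace ℝ (Fin m))} [IsProbabilityMeasure μ]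

instance sampleLaw_isProbabilityMeasure (n : ℕ) : IsProbabilityMeasure (sampleLaw μ k n) := by
  unfold sampleLaw; infer_instance

theorem measurePreserving_sample (n : ℕ) (p : Fin k × Fin n) :
    MeasurePreserving (fun v : Fin k × Fin n → EuclideanSpace ℝ (Fin m) => v p)
      (sampleLaw μ k n) μ :=
  measurePreserving_eval (fun _ => μ) p

theorem variance_sum_sample {F : EuclideanSpace ℝ (Fin m) → ℝ} (hF : Measurable F)
    (hL : MemLp F 2 μ) (n : ℕ) (i : Fin k) :
    Var[∑ l, fun v : Fin k × Fin n → EuclideanSpace ℝ (Fin m) => F (v (i, l)); sampleLaw μ k n]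
      = n * Var[F; μ] := by
  have hind : iIndepFun (fun (p : Fin k × Fin n)
      (v : Fin k × Fin n → EuclideanSpace ℝ (Fin m)) => F (v p)) (sampleLaw μ k n) :=
    iIndepFun_pi (μ := fun _ => μ) (X := fun _ => F) fun _ => hF.aemeasurable
  rw [IndepFun.variance_sum]
  · have : ∀ l : Fin n, Var[fun v : Fin k × Fin n → EuclideanSpace ℝ (Fin m) => F (v (i, l));
        sampleLaw μ k n] = Var[F; μ] := fun l =>
      (measurePreserving_sample n (i, l)).variance_fun_comp hF.aemeasurable
    simp [this]
  · intro l _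
    exact hL.comp_measurePreserving (measurePreserving_sample n (i, l))
  · intro l _ l' _ hll
    exact hind.indepFun (by simpa using hll)

/-- The weak law of large numbers for the points of one ball. -/
theorem whp_abs_sum_sub_lt {F : EuclideanSpace ℝ (Fin m) → ℝ} (hF : Measurable F)
    (hL : MemLp F 2 μ) (i : Fin k) {ε : ℝ} (hε : 0 < ε) :
    WithHighProbability (fun n => sampleLaw μ k n)
      fun n => {v | |∑ l, F (v (i, l)) - n * ∫ x, F x ∂μ| < n * ε} := by
  have hmeas : ∀ n, Measurable
      fun v : Fin k × Fin n → EuclideanSpace ℝ (Fin m) => ∑ l, F (v (i, l)) := fun n =>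
    Finset.measurable_sum _ fun l _ => hF.comp (measurable_pi_apply _)
  apply WithHighProbability.of_compl_le
  · intro n
    exact measurableSet_lt (((hmeas n).sub_const _).abs) measurable_const
  · intro δ hδ
    obtain ⟨N, hN⟩ := exists_nat_gt (Var[F; μ] / (ε ^ 2 * δ))
    refine ⟨N, fun n hn => ?_⟩
    have hn0 : (0 : ℝ) < n := by exact_mod_cast lt_of_le_of_lt (Nat.zero_le _) hn
    have hNn : (N : ℝ) < n := by exact_mod_cast hn
    set X : (Fin k × Fin n → EuclideanSpace ℝ (Fin m)) → ℝ := ∑ l, fun v => F (v (i, l)) with hX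
    have hXapp : ∀ v, X v = ∑ l, F (v (i, l)) := fun v => by simp [hX]
    have hLl : ∀ l : Fin n, MemLp (fun v : Fin k × Fin n → EuclideanSpace ℝ (Fin m) =>
        F (v (i, l))) 2 (sampleLaw μ k n) := fun l =>
      hL.comp_measurePreserving (measurePreserving_sample n (i, l))
    have hXL : MemLp X 2 (sampleLaw μ k n) := memLp_finsetSum' _ fun l _ => hLl l
    have hE : ∫ v, X v ∂(sampleLaw μ k n) = n * ∫ x, F x ∂μ := by
      simp_rw [hXapp]
      rw [integral_finsetSum _ fun l _ => (hLl l).integrable (by norm_num)]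
      have : ∀ l : Fin n, ∫ v : Fin k × Fin n → EuclideanSpace ℝ (Fin m), F (v (i, l))
          ∂(sampleLaw μ k n) = ∫ x, F x ∂μ := by
        intro l
        have hmp := measurePreserving_sample (μ := μ) n (i, l)
        have := integral_map (μ := sampleLaw μ k n) hmp.measurable.aemeasurable
          (f := F) hF.aestronglyMeasurable
        rw [hmp.map_eq] at this
        exact this.symm
      simp [this]
    have hcheb := meas_ge_le_variance_div_sq hXL (c := n * ε) (by positivity)
    rw [hE, hX, variance_sum_sample hF hL, ← hX] at hcheb
    have hset : {v : Fin k × Fin n → EuclideanSpace ℝ (Fin m) |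
        |∑ l, F (v (i, l)) - n * ∫ x, F x ∂μ| < n * ε}ᶜ
        = {v | n * ε ≤ |X v - n * ∫ x, F x ∂μ|} := by
      ext v; simp [hXapp]
    rw [hset]
    refine lt_of_le_of_lt (ENNReal.toReal_le_of_le_ofReal ?_ hcheb) ?_
    · have := variance_nonneg F μ
      positivity
    · rw [div_lt_iff₀ (by positivity)] at hN ⊢
      have : 0 < ε ^ 2 * δ := by positivity
      nlinarith [mul_lt_mul_of_pos_right hNn this]

theorem whp_forall_of_ae {p : EuclideanSpace ℝ (Fin m) → Prop}
    (hp : MeasurableSet {x | p x}) (h : ∀ᵐ x ∂μ, p x) :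
    WithHighProbability (fun n => sampleLaw μ k n) fun _ => {v | ∀ q, p (v q)} := by
  have hm : ∀ n, MeasurableSet {v : Fin k × Fin n → EuclideanSpace ℝ (Fin m) | ∀ q, p (v q)} := by
    intro n
    rw [Set.ofPred_forall]
    exact MeasurableSet.iInter fun q => measurable_pi_apply q hp
  apply WithHighProbability.of_compl_le hm
  intro δ hδ
  refine ⟨0, fun n _ => ?_⟩
  have : ∀ᵐ v ∂(sampleLaw μ k n), ∀ q, p (v q) := by
    rw [ae_all_iff]
    intro q
    exact (measurePreserving_sample n q).quasiMeasurePreserving.ae h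
  have h0 : sampleLaw μ k n {v | ∀ q, p (v q)}ᶜ = 0 := this
  rw [measureReal_def, h0]
  simpa using hδ

/-- Apply the law of large numbers to the indicator of `U`, with tolerance equal to its mean: a
sample missing `U` would deviate by exactly that tolerance, contradicting the strict inequality. -/
theorem whp_exists_mem {U : Set (EuclideanSpace ℝ (Fin m))} (hU : MeasurableSet U) (h : 0 < μ U)
    (i : Fin k) :
    WithHighProbability (fun n => sampleLaw μ k n) fun _ => {v | ∃ l, v (i, l) ∈ U} := by
  classical
  have hpos : 0 < μ.real U := ENNReal.toReal_pos h.ne' (measure_ne_top _ _)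
  have hm : Measurable (U.indicator fun _ => (1 : ℝ)) := measurable_const.indicator hU
  have hL : MemLp (U.indicator fun _ => (1 : ℝ)) 2 μ := memLp_indicator_const _ hU _ (by simp)
  refine (whp_abs_sum_sub_lt hm hL i hpos).mono ⟨0, fun _ _ v hv => ?_⟩
  by_contra hcon
  simp only [Set.mem_ofPred_eq, not_exists] at hcon
  have hz : ∀ l, U.indicator (fun _ => (1 : ℝ)) (v (i, l)) = 0 := fun l => by simp [hcon l]
  simp only [Set.mem_ofPred_eq, hz, Finset.sum_const_zero, zero_sub, abs_neg] at hv
  rw [integral_indicator_const _ hU, smul_eq_mul, mul_one, abs_of_nonneg (by positivity)] at hv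
  exact lt_irrefl _ hv

end SBM

/-! ### The radial measure -/

namespace SBM

/-- The Euclidean plane. -/
abbrev Plane : Type := EuclideanSpace ℝ (Fin 2)

theorem Plane.norm_sq (v : Plane) : ‖v‖ ^ 2 = v 0 ^ 2 + v 1 ^ 2 := by
  simp [EuclideanSpace.norm_sq_eq]

/-- The unnormalized radial profile of the density. -/
noncomputable def profile (m : ℕ) (r : ℝ) : ℝ := r ^ m * max 0 (1 - r)

theorem continuous_profile (m : ℕ) : Continuous (profile m) := by
  unfold profile; fun_prop

theorem profile_nonneg {m : ℕ} {r : ℝ} (hr : 0 ≤ r) : 0 ≤ profile m r :=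
  mul_nonneg (pow_nonneg hr _) (le_max_left _ _)

theorem profile_eq_zero {m : ℕ} {r : ℝ} (hr : 1 ≤ r) : profile m r = 0 := by
  simp [profile, hr]

theorem profile_pos {m : ℕ} {r : ℝ} (hr : 0 < r) (h1 : r < 1) : 0 < profile m r :=
  mul_pos (pow_pos hr _) (lt_max_of_lt_right (by linarith))

/-- Polar coordinates leave the integral of `r ^ (j + m + 1) * (1 - r)` over the unit interval. The
case `j = 0` normalizes the density and `j = 1` gives the mean norm. -/
theorem integral_norm_pow_mul_profile (j m : ℕ) :
    ∫ x : Plane, ‖x‖ ^ j * profile m ‖x‖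
      = 2 * (volume.real (Metric.ball (0 : Plane) 1) * (1 / ((j + m + 2) * (j + m + 3)))) := by
  rw [integral_fun_norm_addHaar volume fun r => r ^ j * profile m r]
  have hdim : Module.finrank ℝ Plane = 2 := by simp
  rw [hdim]
  have hI : ∫ y in Set.Ioi (0 : ℝ), y ^ (2 - 1) • (y ^ j * profile m y)
      = ∫ y in (0 : ℝ)..1, (y ^ (j + m + 1) - y ^ (j + m + 2)) := by
    rw [intervalIntegral.integral_of_le zero_le_one]
    rw [setIntegral_eq_of_subset_of_forall_sdiff_eq_zero measurableSet_Ioi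
      (Set.Ioc_subset_Ioi_self : Set.Ioc (0 : ℝ) 1 ⊆ Set.Ioi 0)]
    · refine setIntegral_congr_fun measurableSet_Ioc fun y hy => ?_
      simp only [profile, smul_eq_mul]
      rw [max_eq_right (by linarith [hy.2])]
      ring
    · intro y hy
      have : 1 < y := by
        by_contra h
        exact hy.2 ⟨hy.1, not_lt.1 h⟩
      simp [profile_eq_zero this.le]
  rw [hI, intervalIntegral.integral_sub
    (Continuous.intervalIntegrable (by fun_prop) _ _)
    (Continuous.intervalIntegrable (by fun_prop) _ _), integral_pow, integral_pow]
  simp only [smul_eq_mul, nsmul_eq_mul, one_pow]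
  push_cast
  have h2 : (j : ℝ) + m + 2 ≠ 0 := by positivity
  have h3 : (j : ℝ) + m + 3 ≠ 0 := by positivity
  have h2' : (j : ℝ) + m + 1 + 1 ≠ 0 := by positivity
  have h3' : (j : ℝ) + m + 2 + 1 ≠ 0 := by positivity
  field_simp
  ring

theorem integral_profile_pos (m : ℕ) : 0 < ∫ x : Plane, profile m ‖x‖ := by
  have h := integral_norm_pow_mul_profile 0 m
  simp only [pow_zero, one_mul] at h
  rw [h]
  have : 0 < volume.real (Metric.ball (0 : Plane) 1) :=
    ENNReal.toReal_pos (Metric.measure_ball_pos _ _ one_pos).ne' measure_ball_lt_top.ne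
  positivity

/-- The normalized radial density. -/
noncomputable def density (m : ℕ) (x : Plane) : ℝ :=
  (∫ x : Plane, profile m ‖x‖)⁻¹ * profile m ‖x‖

theorem continuous_density (m : ℕ) : Continuous (density m) :=
  continuous_const.mul ((continuous_profile m).comp continuous_norm)

theorem density_nonneg (m : ℕ) (x : Plane) : 0 ≤ density m x :=
  mul_nonneg (inv_nonneg.2 (integral_profile_pos m).le) (profile_nonneg (norm_nonneg _))

theorem density_eq_zero {m : ℕ} {x : Plane} (hx : 1 ≤ ‖x‖) : density m x = 0 := by
  simp [density, profile_eq_zero hx]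

theorem density_pos {m : ℕ} {x : Plane} (hx : x ≠ 0) (h1 : ‖x‖ < 1) : 0 < density m x :=
  mul_pos (inv_pos.2 (integral_profile_pos m)) (profile_pos (norm_pos_iff.2 hx) h1)

/-- The probability measure with radial density proportional to `‖x‖ ^ m * (1 - ‖x‖)` on the
unit disc. -/
noncomputable def radialMeasure (m : ℕ) : Measure Plane :=
  volume.withDensity fun x => ENNReal.ofReal (density m x)

theorem integral_radialMeasure (m : ℕ) (g : Plane → ℝ) :
    ∫ x, g x ∂(radialMeasure m) = ∫ x, density m x * g x := by
  rw [radialMeasure, integral_withDensity_eq_integral_toReal_smul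
    (continuous_density m).measurable.ennreal_ofReal (by simp)]
  simp [ENNReal.toReal_ofReal (density_nonneg m _)]

theorem hasContinuousDensity_radialMeasure (m : ℕ) : HasContinuousDensity (radialMeasure m) :=
  ⟨density m, continuous_density m, density_nonneg m, rfl⟩

theorem hasCompactSupport_density (m : ℕ) : HasCompactSupport (density m) := by
  refine HasCompactSupport.intro (isCompact_closedBall (0 : Plane) 1) fun x hx => ?_
  apply density_eq_zero
  simp only [Metric.mem_closedBall, dist_zero_right, not_le] at hx
  exact hx.le

instance isProbabilityMeasure_radialMeasure (m : ℕ) : IsProbabilityMeasure (radialMeasure m) := by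
  constructor
  rw [radialMeasure, withDensity_apply _ MeasurableSet.univ, Measure.restrict_univ,
    ← ofReal_integral_eq_lintegral_ofReal
      ((continuous_density m).integrable_of_hasCompactSupport (hasCompactSupport_density m))
      (Filter.Eventually.of_forall (density_nonneg m))]
  unfold density
  rw [integral_const_mul, inv_mul_cancel₀ (integral_profile_pos m).ne', ENNReal.ofReal_one]

theorem isUnitBallProbability_radialMeasure (m : ℕ) :
    IsUnitBallProbability (radialMeasure m) where
  isProbability := inferInstance
  supported := by
    rw [radialMeasure, withDensity_apply _ Metric.isClosed_closedBall.measurableSet.compl]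
    rw [setLIntegral_congr_fun (g := fun _ => 0)
      Metric.isClosed_closedBall.measurableSet.compl]
    · simp
    · intro x hx
      simp only [Set.mem_compl_iff, Metric.mem_closedBall, dist_zero_right, not_le] at hx
      simp [density_eq_zero hx.le]

theorem ae_norm_le_one (m : ℕ) : ∀ᵐ x ∂(radialMeasure m), ‖x‖ ≤ 1 := by
  have h := (isUnitBallProbability_radialMeasure m).supported
  rw [ae_iff]
  convert h using 2
  ext x
  simp

theorem isRotationInvariant_radialMeasure (m : ℕ) : IsRotationInvariant (radialMeasure m) := by
  intro A
  ext s hs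
  rw [Measure.map_apply A.continuous.measurable hs, radialMeasure,
    withDensity_apply _ hs, withDensity_apply _ (A.continuous.measurable hs),
    ← A.measurePreserving.setLIntegral_comp_preimage hs
      (continuous_density m).measurable.ennreal_ofReal]
  simp [density]

/-- Inside the open disc the density can vanish only at the origin, and a nonempty open set has
other points. This yields both the mass near the center and the sample points near prescribed
medians. -/
theorem radialMeasure_pos_of_isOpen (m : ℕ) {U : Set Plane} (hU : IsOpen U)
    (h : (U ∩ Metric.ball 0 1).Nonempty) : 0 < radialMeasure m U := by
  obtain ⟨x, ⟨hxU, hx1⟩, hx0⟩ := (dense_compl_singleton (0 : Plane)).inter_open_nonempty _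
    (hU.inter Metric.isOpen_ball) h
  rw [radialMeasure, withDensity_apply _ hU.measurableSet,
    setLIntegral_pos_iff (continuous_density m).measurable.ennreal_ofReal]
  have hopen : IsOpen (U ∩ {x | 0 < density m x}) :=
    hU.inter (isOpen_lt continuous_const (continuous_density m))
  refine (hopen.measure_pos volume ⟨x, hxU, density_pos hx0 (by simpa using hx1)⟩).trans_le
    (measure_mono ?_)
  rintro y ⟨hyU, hy⟩
  exact ⟨by simpa using hy, hyU⟩

theorem hasMassNearCenter_radialMeasure (m : ℕ) : HasMassNearCenter (radialMeasure m) :=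
  fun _ hU h0 => radialMeasure_pos_of_isOpen m hU ⟨0, h0, by simp⟩

theorem integral_norm_radialMeasure (m : ℕ) :
    ∫ x, ‖x‖ ∂(radialMeasure m) = (m + 2) / (m + 4) := by
  rw [integral_radialMeasure]
  have h0 := integral_norm_pow_mul_profile 0 m
  have h1 := integral_norm_pow_mul_profile 1 m
  have hp := integral_profile_pos m
  simp only [pow_zero, one_mul] at h0
  simp only [pow_one] at h1
  have : ∀ x : Plane, density m x * ‖x‖
      = (∫ x : Plane, profile m ‖x‖)⁻¹ * (‖x‖ * profile m ‖x‖) := fun x => by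
    unfold density; ring
  simp_rw [this]
  rw [integral_const_mul, h1]
  rw [h0] at hp ⊢
  have hV : volume.real (Metric.ball (0 : Plane) 1) ≠ 0 := by
    rintro h; simp [h] at hp
  push_cast
  have h2 : (m : ℝ) + 2 ≠ 0 := by positivity
  have h3 : (m : ℝ) + 3 ≠ 0 := by positivity
  have h4 : (m : ℝ) + 4 ≠ 0 := by positivity
  have h3' : (1 : ℝ) + m + 2 ≠ 0 := by positivity
  have h4' : (1 : ℝ) + m + 3 ≠ 0 := by positivity
  rw [zero_add]
  field_simp
  ring

theorem memLp_radialMeasure_of_continuous (m : ℕ) {F : Plane → ℝ} (hF : Continuous F) :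
    MemLp F 2 (radialMeasure m) := by
  obtain ⟨C, hC⟩ := (isCompact_closedBall (0 : Plane) 1).exists_bound_of_continuousOn
    hF.continuousOn
  refine MemLp.of_bound hF.aestronglyMeasurable C ?_
  filter_upwards [ae_norm_le_one m] with x hx
  exact hC x (by simpa using hx)

theorem integrable_radialMeasure_of_continuous (m : ℕ) {F : Plane → ℝ} (hF : Continuous F) :
    Integrable F (radialMeasure m) :=
  (memLp_radialMeasure_of_continuous m hF).integrable (by norm_num)

end SBM

/-! ### Coordinate moments of rotation invariant measures -/

namespace SBM

open Real

/-- The linear isometry of the plane with matrix `!![c, -s; s, c]`. -/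
noncomputable def planeRotation (c s : ℝ) (h : c ^ 2 + s ^ 2 = 1) : Plane ≃ₗᵢ[ℝ] Plane :=
  LinearIsometry.toLinearIsometryEquiv
    { toFun := fun v => !₂[c * v 0 - s * v 1, s * v 0 + c * v 1]
      map_add' := fun v w => by ext i; fin_cases i <;> simp <;> ring
      map_smul' := fun a v => by ext i; fin_cases i <;> simp <;> ring
      norm_map' := fun v => by
        rw [← sq_eq_sq₀ (norm_nonneg _) (norm_nonneg _), Plane.norm_sq, Plane.norm_sq]
        simp
        linear_combination (v 0 ^ 2 + v 1 ^ 2) * h } rfl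

@[simp] theorem planeRotation_zero (c s : ℝ) (h : c ^ 2 + s ^ 2 = 1) (v : Plane) :
    planeRotation c s h v 0 = c * v 0 - s * v 1 := rfl

@[simp] theorem planeRotation_one (c s : ℝ) (h : c ^ 2 + s ^ 2 = 1) (v : Plane) :
    planeRotation c s h v 1 = s * v 0 + c * v 1 := rfl

theorem integral_comp_isometry {μ : Measure Plane} (hμ : IsRotationInvariant μ)
    (A : Plane ≃ₗᵢ[ℝ] Plane) (F : Plane → ℝ) : ∫ v, F (A v) ∂μ = ∫ v, F v ∂μ := by
  conv_rhs => rw [← hμ A]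
  exact (A.toHomeomorph.measurableEmbedding.integral_map F).symm

/-- By `π`-periodicity the window moves to `[-π/2, π/2]`, where cosine is nonnegative. -/
theorem integral_abs_cos_add (θ : ℝ) : ∫ t in (0 : ℝ)..π, |cos (t + θ)| = 2 := by
  have hper : Function.Periodic (fun t => |cos t|) π := fun t => by simp [cos_add_pi]
  rw [intervalIntegral.integral_comp_add_right fun t => |cos t|, zero_add, add_comm π θ,
    hper.intervalIntegral_add_eq θ (-(π / 2))]
  have : -(π / 2) + π = π / 2 := by ring
  rw [this, intervalIntegral.integral_congr (g := cos)]
  · rw [integral_cos, sin_neg, sin_pi_div_two]; norm_num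
  · intro t ht
    rw [Set.uIcc_of_le (by linarith [pi_pos])] at ht
    exact abs_of_nonneg (cos_nonneg_of_mem_Icc ht)

theorem integral_abs_rotate (v : Plane) :
    ∫ t in (0 : ℝ)..π, |cos t * v 0 - sin t * v 1| = 2 * ‖v‖ := by
  set z : ℂ := ⟨v 0, v 1⟩ with hz
  have hnorm : ‖z‖ = ‖v‖ := by
    rw [← sq_eq_sq₀ (norm_nonneg _) (norm_nonneg _), Plane.norm_sq, ← Complex.normSq_eq_norm_sq,
      Complex.normSq_apply]
    simp [hz]; ring
  have h0 : v 0 = ‖v‖ * cos z.arg := by rw [← hnorm, Complex.norm_mul_cos_arg]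
  have h1 : v 1 = ‖v‖ * sin z.arg := by rw [← hnorm, Complex.norm_mul_sin_arg]
  have : ∀ t, |cos t * v 0 - sin t * v 1| = ‖v‖ * |cos (t + z.arg)| := by
    intro t
    rw [show cos t * v 0 - sin t * v 1 = ‖v‖ * cos (t + z.arg) by
      rw [cos_add]; linear_combination cos t * h0 - sin t * h1, abs_mul, abs_norm]
  simp_rw [this]
  rw [intervalIntegral.integral_const_mul, integral_abs_cos_add]
  ring

/-- The first absolute moment of a coordinate under a rotation invariant measure. -/
theorem pi_mul_integral_abs_coord {μ : Measure Plane} [IsProbabilityMeasure μ]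
    (hμ : IsRotationInvariant μ) (hint : Integrable (fun v : Plane => ‖v‖) μ) :
    π * ∫ v, |v 0| ∂μ = 2 * ∫ v, ‖v‖ ∂μ := by
  have hrot : ∀ t : ℝ, ∫ v : Plane, |cos t * v 0 - sin t * v 1| ∂μ = ∫ v : Plane, |v 0| ∂μ :=
    fun t => integral_comp_isometry hμ (planeRotation (cos t) (sin t) (cos_sq_add_sin_sq t))
      fun v => |v 0|
  have hleft : ∫ t in (0 : ℝ)..π, ∫ v : Plane, |cos t * v 0 - sin t * v 1| ∂μ
      = π * ∫ v, |v 0| ∂μ := by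
    simp_rw [hrot]; simp
  -- Averaging over the angle `t` and swapping the integrals turns the coordinate into the norm;
  -- domination by `2 * ‖v‖` justifies Fubini.
  have hprod : Integrable (Function.uncurry fun (t : ℝ) (v : Plane) =>
      |cos t * v 0 - sin t * v 1|) ((volume.restrict (Set.Ioc 0 π)).prod μ) := by
    have hb : Integrable (fun p : ℝ × Plane => 2 * ‖p.2‖)
        ((volume.restrict (Set.Ioc 0 π)).prod μ) := (hint.comp_snd _).const_mul 2
    refine hb.mono' (Continuous.aestronglyMeasurable (by fun_prop)) ?_
    refine Filter.Eventually.of_forall fun p => ?_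
    have e0 : |p.2 0| ≤ ‖p.2‖ := PiLp.norm_apply_le p.2 0
    have e1 : |p.2 1| ≤ ‖p.2‖ := PiLp.norm_apply_le p.2 1
    simp only [Function.uncurry, norm_eq_abs, abs_abs]
    calc |cos p.1 * p.2 0 - sin p.1 * p.2 1|
        ≤ |cos p.1 * p.2 0| + |sin p.1 * p.2 1| := abs_sub _ _
      _ ≤ 1 * ‖p.2‖ + 1 * ‖p.2‖ := by
        rw [abs_mul, abs_mul]
        gcongr
        · exact abs_cos_le_one _
        · exact abs_sin_le_one _
      _ = 2 * ‖p.2‖ := by ring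
  rw [← hleft, intervalIntegral.integral_of_le pi_pos.le, integral_integral_swap hprod]
  simp_rw [← intervalIntegral.integral_of_le pi_pos.le, integral_abs_rotate]
  rw [integral_const_mul]

/-- The antipodal map is an isometry. This cancels the linear terms of the service bounds and the
mean directions. -/
theorem integral_coord_eq_zero {μ : Measure Plane} (hμ : IsRotationInvariant μ) {F : Plane → ℝ}
    (hF : ∀ v, F (-v) = -F v) : ∫ v, F v ∂μ = 0 := by
  have h := integral_comp_isometry hμ (LinearIsometryEquiv.neg ℝ) F
  simp only [LinearIsometryEquiv.coe_neg, hF, integral_neg] at h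
  linarith

/-- An eighth turn converts the maximum into `(|v 0| + |v 1|) / √2`, because `max |a - b| |a + b| =
|a| + |b|`; a quarter turn makes the two coordinate moments equal. -/
theorem integral_max_abs {μ : Measure Plane} (hμ : IsRotationInvariant μ)
    (hint : Integrable (fun v : Plane => ‖v‖) μ) :
    ∫ v : Plane, max |v 0| |v 1| ∂μ = √2 * ∫ v : Plane, |v 0| ∂μ := by
  have h2 : √2 ^ 2 = 2 := sq_sqrt (by norm_num)
  have hs : (√2 / 2) ^ 2 + (√2 / 2) ^ 2 = 1 := by rw [div_pow, h2]; norm_num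
  have hc : ∀ i : Fin 2, Integrable (fun v : Plane => |v i|) μ := fun i =>
    hint.mono' (Continuous.aestronglyMeasurable (by fun_prop))
      (Filter.Eventually.of_forall fun v => by simpa using PiLp.norm_apply_le v i)
  have hrot := integral_comp_isometry hμ (planeRotation _ _ hs) fun v => max |v 0| |v 1|
  have hquart := integral_comp_isometry hμ (planeRotation 0 1 (by norm_num)) fun v => |v 0|
  simp only [planeRotation_zero, zero_mul, one_mul, zero_sub, abs_neg] at hquart
  have hpt : ∀ v : Plane, max |planeRotation _ _ hs v 0| |planeRotation _ _ hs v 1|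
      = √2 / 2 * (|v 0| + |v 1|) := by
    intro v
    have hpos : (0 : ℝ) ≤ √2 / 2 := by positivity
    rw [planeRotation_zero, planeRotation_one, ← mul_sub, ← mul_add, abs_mul, abs_mul,
      abs_of_nonneg hpos, ← mul_max_of_nonneg _ _ hpos]
    congr 1
    rcases abs_cases (v 0) with h | h <;> rcases abs_cases (v 1) with h' | h' <;>
      rcases abs_cases (v 0 - v 1) with k | k <;> rcases abs_cases (v 0 + v 1) with k' | k' <;>
      rcases max_cases |v 0 - v 1| |v 0 + v 1| with j | j <;> linarith
  simp_rw [hpt] at hrot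
  rw [← hrot, integral_const_mul, integral_add (hc 0) (hc 1), hquart]
  ring

end SBM

/-! ### Structure of an exactly recovering solution -/

namespace KMedian

variable {X : Type*} [MetricSpace X] {k n : ℕ}

/-- Under exact recovery every ball contains exactly one open center, which serves the points of
that ball, and the resulting cost is at most the cost of any other assignment to `k` points. -/
theorem AchievesExactRecovery.exists_centers {x : Fin k × Fin n → X}
    (h : AchievesExactRecovery x) (hn : 0 < n) {P : Fin k → Fin k × Fin n}
    (hP : Function.Injective P) (σ : Fin k × Fin n → Fin k) :
    ∃ p : Fin k → Fin k × Fin n, (∀ i, (p i).1 = i) ∧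
      ∑ q, dist (x (p q.1)) (x q) ≤ ∑ q, dist (x (P (σ q))) (x q) := by
  classical
  obtain ⟨y, z, ⟨hf, hopt⟩, -, hI, hsame⟩ := h
  have hex : ∀ q, ∃ p, z p q = 1 := by
    intro q
    by_contra hcon
    push Not at hcon
    have : ∑ p, z p q = 0 := Finset.sum_eq_zero fun p _ => (hI.z_binary p q).resolve_right (hcon p)
    rw [hf.assigned q] at this
    exact one_ne_zero this
  choose c hc using hex
  set p : Fin k → Fin k × Fin n := fun i => c (i, ⟨0, hn⟩) with hp
  have hp1 : ∀ i, (p i).1 = i := fun i => hsame _ _ (hc _)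
  have hpinj : Function.Injective p := fun i j hij => by rw [← hp1 i, hij, hp1 j]
  have hyp : ∀ i, y (p i) = 1 := by
    intro i
    have h1 := hf.le_open (p i) (i, ⟨0, hn⟩)
    rw [hp, hc] at h1
    rcases hI.y_binary (p i) with h0 | h0
    · rw [h0] at h1; linarith
    · exact h0
  -- The `k` centers `p i`, each open with weight `1`, exhaust the budget `∑ y = k`.
  have hy0 : ∀ q, q ∉ Set.range p → y q = 0 := by
    intro q hq
    have hle : ∑ i ∈ insert q (Finset.univ.image p), y i ≤ ∑ i, y i :=
      Finset.sum_le_sum_of_subset_of_nonneg (Finset.subset_univ _) fun i _ _ => hf.y_nonneg i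
    rw [Finset.sum_insert (by simpa using hq), Finset.sum_image fun i _ j _ hij => hpinj hij,
      hf.sum_open] at hle
    simp only [hyp, Finset.sum_const, Finset.card_univ, Fintype.card_fin, nsmul_eq_mul,
      mul_one] at hle
    exact le_antisymm (by linarith) (hf.y_nonneg q)
  have hcp : ∀ q, c q = p q.1 := by
    intro q
    by_cases hr : c q ∈ Set.range p
    · obtain ⟨i, hi⟩ := hr
      have : i = q.1 := by rw [← hp1 i, hi]; exact hsame _ _ (hc q)
      rw [← this, hi]
    · have h1 := hf.le_open (c q) q
      rw [hc, hy0 _ hr] at h1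
      linarith
  refine ⟨p, hp1, ?_⟩
  have hlow : ∑ q, dist (x (p q.1)) (x q) ≤ cost x z := by
    rw [cost, Finset.sum_comm]
    refine Finset.sum_le_sum fun q _ => ?_
    calc dist (x (p q.1)) (x q) = dist (x (c q)) (x q) * z (c q) q := by rw [hc, hcp, mul_one]
      _ ≤ _ := Finset.single_le_sum (f := fun r => dist (x r) (x q) * z r q)
        (fun r _ => mul_nonneg dist_nonneg (hf.z_nonneg r q)) (Finset.mem_univ _)
  -- The competing assignment is itself LP-feasible; injectivity of `P` gives exactly `k` open
  -- points.
  set y' : Fin k × Fin n → ℝ := fun r => if r ∈ Set.range P then 1 else 0 with hy'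
  set z' : Fin k × Fin n → Fin k × Fin n → ℝ := fun r q => if r = P (σ q) then 1 else 0 with hz'
  have hfeas : LPFeasible k y' z' :=
    { assigned := fun q => by simp [hz']
      le_open := fun r q => by
        simp only [hy', hz']
        split_ifs with h1 h2 h2
        · exact le_rfl
        · exact absurd ⟨_, h1.symm⟩ h2
        · exact zero_le_one
        · exact le_rfl
      sum_open := by
        have : (Finset.univ.filter fun r => r ∈ Set.range P) = Finset.univ.image P := by
          ext r; simp
        simp only [hy']
        rw [Finset.sum_boole, this, Finset.card_image_of_injective _ hP]
        simp
      y_nonneg := fun r => by simp only [hy']; split_ifs <;> norm_num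
      z_nonneg := fun r q => by simp only [hz']; split_ifs <;> norm_num }
  refine hlow.trans ((hopt y' z' hfeas).trans_eq ?_)
  rw [cost, Finset.sum_comm]
  simp [hz']

end KMedian

/-! ### Lower bound for the cost of one center per ball -/

namespace SBM

theorem Plane.inner_le_norm_mul_norm (u v : Plane) : u 0 * v 0 + u 1 * v 1 ≤ ‖u‖ * ‖v‖ := by
  have h := real_inner_le_norm u v
  rw [PiLp.inner_apply] at h
  simp only [Fin.sum_univ_two] at h
  simp only [RCLike.inner_apply, conj_trivial] at h
  linarith

/-- The `i`-th coordinate of the direction of a vector. -/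
noncomputable def direction (i : Fin 2) (v : Plane) : ℝ := ‖v‖⁻¹ * v i

theorem abs_direction_le (i : Fin 2) (v : Plane) : |direction i v| ≤ 1 := by
  rw [direction, abs_mul, abs_inv, abs_norm]
  exact inv_mul_le_one_of_le₀ (PiLp.norm_apply_le v i) (norm_nonneg _)

theorem direction_neg (i : Fin 2) (v : Plane) : direction i (-v) = -direction i v := by
  simp [direction]

theorem measurable_direction (i : Fin 2) : Measurable (direction i) := by
  have h : Continuous fun v : Plane => v i := by fun_prop
  exact measurable_norm.inv.mul h.measurable

/-- Cauchy–Schwarz for `v - w` against the unit vector along `v`. The correction is linear in `w`,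
so after summation only the total direction matters, whichever `w` the sample selects. -/
theorem norm_sub_direction_le (v w : Plane) :
    ‖v‖ - (w 0 * direction 0 v + w 1 * direction 1 v) ≤ ‖w - v‖ := by
  rcases eq_or_ne v 0 with rfl | hv
  · simp [direction]
  have hpos : 0 < ‖v‖ := norm_pos_iff.2 hv
  have h := Plane.inner_le_norm_mul_norm (v - w) v
  have hsq := Plane.norm_sq v
  simp only [PiLp.sub_apply] at h
  rw [norm_sub_rev w v]
  refine le_of_mul_le_mul_right ?_ hpos
  refine le_trans (le_of_eq ?_) h
  unfold direction
  field_simp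
  linear_combination hsq

/-- Any single center of norm at most one costs nearly as much as the origin when the directions
of the points are balanced. -/
theorem sum_norm_sub_le_sum_dist {ι : Type*} [Fintype ι] (v : ι → Plane) {w : Plane}
    (hw : ‖w‖ ≤ 1) :
    ∑ l, ‖v l‖ - |∑ l, direction 0 (v l)| - |∑ l, direction 1 (v l)| ≤ ∑ l, ‖w - v l‖ := by
  have h := Finset.sum_le_sum fun l (_ : l ∈ Finset.univ) => norm_sub_direction_le (v l) w
  rw [Finset.sum_sub_distrib, Finset.sum_add_distrib, ← Finset.mul_sum, ← Finset.mul_sum] at h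
  have hb : ∀ (i : Fin 2) (S : ℝ), w i * S ≤ |S| := fun i S => by
    calc w i * S ≤ |w i * S| := le_abs_self _
      _ = |w i| * |S| := abs_mul _ _
      _ ≤ 1 * |S| := by gcongr; exact (PiLp.norm_apply_le w i).trans hw
      _ = |S| := one_mul _
  linarith [hb 0 (∑ l, direction 0 (v l)), hb 1 (∑ l, direction 1 (v l))]

/-! ### The competing solution and its service bounds -/

/-- The center of one ball, four neighbors at distance `2.2`, and two further corners of the
square grid. -/
noncomputable def gridCenter (i : Fin 7) : Plane :=
  !₂[2.2 * (![0, 1, 0, -1, 0, 1, -1] : Fin 7 → ℝ) i, 2.2 * (![0, 0, 1, 0, -1, 1, -1] : Fin 7 → ℝ) i]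

/-- The ball in which the `j`-th median of the competing solution lies. -/
def home : Fin 7 → Fin 7 := ![1, 1, 2, 3, 4, 5, 6]

/-- The position of the `j`-th median of the competing solution, relative to its ball. -/
noncomputable def offset (j : Fin 7) : Plane :=
  !₂[(![4 / 5, -(4 / 5), 0, 6 / 25, 0, 0, 0] : Fin 7 → ℝ) j,
    (![0, 0, -(6 / 25), 0, 6 / 25, 0, 0] : Fin 7 → ℝ) j]

theorem isLeast_dist_gridCenter :
    IsLeast {t : ℝ | ∃ i j : Fin 7, i ≠ j ∧ t = dist (gridCenter i) (gridCenter j)} (2.2 : ℝ) := by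
  constructor
  · refine ⟨0, 1, by decide, ?_⟩
    refine (sq_eq_sq₀ (by norm_num) dist_nonneg).1 ?_
    rw [dist_eq_norm, Plane.norm_sq]
    simp [gridCenter]
  · rintro t ⟨i, j, hij, rfl⟩
    refine le_of_sq_le_sq ?_ dist_nonneg
    rw [dist_eq_norm, Plane.norm_sq]
    fin_cases i <;> fin_cases j <;> first | exact absurd rfl hij | (simp [gridCenter] <;> norm_num)

/-- An affine bound for the distance from the points of a ball to a median at distance `b` from
the center of the ball, in terms of the coordinate `t` in the direction of the median. -/
noncomputable def tangentBound (s b t : ℝ) : ℝ := (s + (1 + b ^ 2 - 2 * b * t) / s) / 2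

/-- The right side is the tangent to the square root at `s ^ 2`, hence affine in `X`. The later
choices `2/3`, `23/20`, `79/100`, `257/250` approximate the square root of the mean of `X`, where
the tangent loses least; for the two unshifted corner medians `257/250` is only slightly too large.
-/
theorem norm_le_of_sq_le {w : Plane} {s X : ℝ} (hs : 0 < s) (h : ‖w‖ ^ 2 ≤ X) :
    ‖w‖ ≤ (s + X / s) / 2 := by
  have : 2 * s * ‖w‖ ≤ s ^ 2 + X := by nlinarith [sq_nonneg (‖w‖ - s)]
  rw [le_div_iff₀ two_pos]
  have e : s + X / s = (s ^ 2 + X) / s := by field_simp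
  rw [e, le_div_iff₀ hs]
  linarith

/-- Upper bounds for the service cost of the points of each ball in the competing solution. -/
noncomputable def serviceBound (i : Fin 7) (v : Plane) : ℝ :=
  if i = 0 then
    min (min (tangentBound (2 / 3) (7 / 5) (v 0)) (tangentBound (23 / 20) (49 / 25) (v 1)))
      (min (tangentBound (23 / 20) (49 / 25) (-v 0)) (tangentBound (23 / 20) (49 / 25) (-v 1)))
  else if i = 1 then tangentBound (79 / 100) (4 / 5) |v 0|
  else (257 / 250 + (1 + ‖offset i‖ ^ 2 - 2 * (offset i 0 * v 0 + offset i 1 * v 1))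
    / (257 / 250)) / 2

theorem continuous_serviceBound (i : Fin 7) : Continuous (serviceBound i) := by
  unfold serviceBound tangentBound
  split_ifs <;> fun_prop

theorem exists_dist_le_serviceBound (i : Fin 7) {v : Plane} (hv : ‖v‖ ≤ 1) :
    ∃ j, dist (gridCenter (home j) + offset j) (gridCenter i + v) ≤ serviceBound i v := by
  have hsq : v 0 ^ 2 + v 1 ^ 2 ≤ 1 := by
    rw [← Plane.norm_sq]; exact pow_le_one₀ (norm_nonneg _) hv
  simp only [dist_eq_norm]
  by_cases h0 : i = 0
  · subst h0
    simp only [serviceBound, if_true]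
    -- The nearest median is at distance `2.2 - 0.8 = 7/5` from the origin, the other three at `2.2
    -- - 0.24 = 49/25`.
    have e1 : ‖gridCenter (home 1) + offset 1 - (gridCenter 0 + v)‖
        ≤ tangentBound (2 / 3) (7 / 5) (v 0) := by
      apply norm_le_of_sq_le (by norm_num)
      rw [Plane.norm_sq]
      simp [gridCenter, home, offset]
      linarith
    have e2 : ‖gridCenter (home 2) + offset 2 - (gridCenter 0 + v)‖
        ≤ tangentBound (23 / 20) (49 / 25) (v 1) := by
      apply norm_le_of_sq_le (by norm_num)
      rw [Plane.norm_sq]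
      simp [gridCenter, home, offset]
      linarith
    have e3 : ‖gridCenter (home 3) + offset 3 - (gridCenter 0 + v)‖
        ≤ tangentBound (23 / 20) (49 / 25) (-v 0) := by
      apply norm_le_of_sq_le (by norm_num)
      rw [Plane.norm_sq]
      simp [gridCenter, home, offset]
      linarith
    have e4 : ‖gridCenter (home 4) + offset 4 - (gridCenter 0 + v)‖
        ≤ tangentBound (23 / 20) (49 / 25) (-v 1) := by
      apply norm_le_of_sq_le (by norm_num)
      rw [Plane.norm_sq]
      simp [gridCenter, home, offset]
      linarith
    rcases min_choice (min (tangentBound (2 / 3) (7 / 5) (v 0))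
      (tangentBound (23 / 20) (49 / 25) (v 1))) (min (tangentBound (23 / 20) (49 / 25) (-v 0))
        (tangentBound (23 / 20) (49 / 25) (-v 1))) with h | h <;> rw [h]
    · rcases min_choice (tangentBound (2 / 3) (7 / 5) (v 0))
        (tangentBound (23 / 20) (49 / 25) (v 1)) with h | h <;> rw [h]
      exacts [⟨1, e1⟩, ⟨2, e2⟩]
    · rcases min_choice (tangentBound (23 / 20) (49 / 25) (-v 0))
        (tangentBound (23 / 20) (49 / 25) (-v 1)) with h | h <;> rw [h]
      exacts [⟨3, e3⟩, ⟨4, e4⟩]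
  by_cases h1 : i = 1
  · subst h1
    simp only [serviceBound, if_true, if_neg h0]
    rcases le_total 0 (v 0) with h | h
    · refine ⟨0, norm_le_of_sq_le (by norm_num) ?_⟩
      rw [Plane.norm_sq, abs_of_nonneg h]
      simp [gridCenter, home, offset]
      linarith
    · refine ⟨1, norm_le_of_sq_le (by norm_num) ?_⟩
      rw [Plane.norm_sq, abs_of_nonpos h]
      simp [gridCenter, home, offset]
      linarith
  · refine ⟨i, ?_⟩
    have hi : home i = i := by fin_cases i <;> first | rfl | exact absurd rfl h0
    rw [hi, add_sub_add_left_eq_sub]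
    simp only [serviceBound, if_neg h0, if_neg h1]
    apply norm_le_of_sq_le (by norm_num)
    rw [Plane.norm_sq, Plane.norm_sq]
    simp only [PiLp.sub_apply]
    linarith

theorem norm_offset_lt_one (j : Fin 7) : ‖offset j‖ < 1 := by
  refine lt_of_pow_lt_pow_left₀ 2 zero_le_one ?_
  rw [Plane.norm_sq]
  fin_cases j <;> simp [offset] <;> norm_num

end SBM

/-! ### Expected cost of the competing solution -/

namespace SBM

theorem serviceBound_zero_le (v : Plane) :
    serviceBound 0 v ≤ tangentBound (2 / 3) (7 / 5) (v 0) ∧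
    serviceBound 0 v ≤ tangentBound (23 / 20) (49 / 25) (v 1) ∧
    serviceBound 0 v ≤ tangentBound (23 / 20) (49 / 25) (-v 0) ∧
    serviceBound 0 v ≤ tangentBound (23 / 20) (49 / 25) (-v 1) := by
  simp only [serviceBound, if_true]
  exact ⟨(min_le_left _ _).trans (min_le_left _ _), (min_le_left _ _).trans (min_le_right _ _),
    (min_le_right _ _).trans (min_le_left _ _), (min_le_right _ _).trans (min_le_right _ _)⟩

/-- Averaging over quarter turns sends each quadrant once to each of the four medians. -/
theorem sum_serviceBound_zero_rotate_le (v : Plane) :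
    serviceBound 0 v + serviceBound 0 (planeRotation 0 1 (by norm_num) v)
      + serviceBound 0 (planeRotation (-1) 0 (by norm_num) v)
      + serviceBound 0 (planeRotation 0 (-1) (by norm_num) v)
      ≤ tangentBound (2 / 3) (7 / 5) (max |v 0| |v 1|)
        + 3 * tangentBound (23 / 20) (49 / 25) (max |v 0| |v 1|) := by
  obtain ⟨a1, a2, a3, a4⟩ := serviceBound_zero_le v
  obtain ⟨b1, b2, b3, b4⟩ := serviceBound_zero_le (planeRotation 0 1 (by norm_num) v)
  obtain ⟨c1, c2, c3, c4⟩ := serviceBound_zero_le (planeRotation (-1) 0 (by norm_num) v)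
  obtain ⟨d1, d2, d3, d4⟩ := serviceBound_zero_le (planeRotation 0 (-1) (by norm_num) v)
  simp only [planeRotation_zero, planeRotation_one, zero_mul, one_mul, neg_mul, zero_sub, add_zero,
    sub_neg_eq_add, zero_add, neg_neg, sub_zero] at b1 b2 b3 b4 c1 c2 c3 c4 d1 d2 d3 d4
  rcases max_choice |v 0| |v 1| with h | h <;> rw [h]
  · rcases abs_choice (v 0) with h | h <;> rw [h] <;> linarith
  · rcases abs_choice (v 1) with h | h <;> rw [h] <;> linarith

variable {μ : Measure Plane} [IsProbabilityMeasure μ]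

theorem integral_tangent_affine {f : Plane → ℝ} (hf : Integrable f μ) (s A : ℝ) (B : ℝ) :
    ∫ v, (s + (A - B * f v) / s) / 2 ∂μ = (s + (A - B * ∫ v, f v ∂μ) / s) / 2 := by
  have h1 : Integrable (fun v => B * f v) μ := hf.const_mul _
  have h2 : Integrable (fun v => (A - B * f v) / s) μ := ((integrable_const A).sub h1).div_const _
  rw [integral_div, integral_add (integrable_const _) h2, integral_div,
    integral_sub (integrable_const _) h1, integral_const_mul]
  simp

theorem integral_tangentBound {f : Plane → ℝ} (hf : Integrable f μ) (s b : ℝ) :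
    ∫ v, tangentBound s b (f v) ∂μ = tangentBound s b (∫ v, f v ∂μ) :=
  integral_tangent_affine hf s _ _

/-- The four rotated copies have equal integrals, so the pointwise orbit bound integrates to four
times the cost of the middle ball. -/
theorem integral_serviceBound_zero_le (hμ : IsRotationInvariant μ)
    (hint : ∀ F : Plane → ℝ, Continuous F → Integrable F μ) :
    4 * ∫ v, serviceBound 0 v ∂μ ≤ tangentBound (2 / 3) (7 / 5) (√2 * ∫ v : Plane, |v 0| ∂μ)
      + 3 * tangentBound (23 / 20) (49 / 25) (√2 * ∫ v : Plane, |v 0| ∂μ) := by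
  have hS : ∀ A : Plane ≃ₗᵢ[ℝ] Plane, Integrable (fun v => serviceBound 0 (A v)) μ := fun A =>
    hint _ ((continuous_serviceBound 0).comp A.continuous)
  have hS0 : Integrable (fun v => serviceBound 0 v) μ := hint _ (continuous_serviceBound 0)
  have hmax : Integrable (fun v : Plane => max |v 0| |v 1|) μ := hint _ (by fun_prop)
  have hT : ∀ s b, Integrable (fun v : Plane => tangentBound s b (max |v 0| |v 1|)) μ :=
    fun s b => hint _ (by unfold tangentBound; fun_prop)
  set R := planeRotation 0 1 (by norm_num)
  set R' := planeRotation (-1) 0 (by norm_num)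
  set R'' := planeRotation 0 (-1) (by norm_num)
  have h2 : Integrable (fun v => serviceBound 0 v + serviceBound 0 (R v)) μ := hS0.add (hS R)
  have h3 : Integrable (fun v => serviceBound 0 v + serviceBound 0 (R v) + serviceBound 0 (R' v))
    μ := h2.add (hS R')
  have h := integral_mono (h3.add (hS R''))
    ((hT (2 / 3) (7 / 5)).add ((hT (23 / 20) (49 / 25)).const_mul 3))
    sum_serviceBound_zero_rotate_le
  simp only [Pi.add_apply] at h
  rw [integral_add h3 (hS R''), integral_add h2 (hS R'), integral_add hS0 (hS R),
    integral_add (hT _ _) ((hT _ _).const_mul _), integral_const_mul,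
    integral_tangentBound hmax, integral_tangentBound hmax,
    integral_max_abs hμ (hint _ continuous_norm)] at h
  simp only [integral_comp_isometry hμ _ (serviceBound 0)] at h
  linarith

theorem integral_serviceBound_one
    (hint : ∀ F : Plane → ℝ, Continuous F → Integrable F μ) :
    ∫ v, serviceBound 1 v ∂μ = tangentBound (79 / 100) (4 / 5) (∫ v : Plane, |v 0| ∂μ) := by
  rw [← integral_tangentBound (hint _ (by fun_prop))]
  simp [serviceBound]

theorem integral_serviceBound_of_ne (hμ : IsRotationInvariant μ)
    (hint : ∀ F : Plane → ℝ, Continuous F → Integrable F μ) {i : Fin 7} (h0 : i ≠ 0)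
    (h1 : i ≠ 1) :
    ∫ v, serviceBound i v ∂μ = (257 / 250 + (1 + ‖offset i‖ ^ 2) / (257 / 250)) / 2 := by
  simp only [serviceBound, if_neg h0, if_neg h1]
  have hL : Integrable (fun v : Plane => offset i 0 * v 0 + offset i 1 * v 1) μ :=
    hint _ (by fun_prop)
  rw [integral_tangent_affine hL,
    integral_coord_eq_zero hμ (F := fun v => offset i 0 * v 0 + offset i 1 * v 1)
      (fun v => by simp; ring)]
  simp

/-- The competing solution is cheaper than exact recovery in expectation. -/
theorem sum_integral_serviceBound_lt :
    ∑ i, ∫ v, (serviceBound i v - ‖v‖) ∂(radialMeasure 1000) < -(1 / 20) := by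
  set μ := radialMeasure 1000 with hμdef
  have hμ : IsRotationInvariant μ := isRotationInvariant_radialMeasure _
  have hint : ∀ F : Plane → ℝ, Continuous F → Integrable F μ := fun F hF =>
    integrable_radialMeasure_of_continuous _ hF
  have hnorm : ∫ v, ‖v‖ ∂μ = 501 / 502 := by
    rw [hμdef, integral_norm_radialMeasure]; norm_num
  have hk := pi_mul_integral_abs_coord hμ (hint _ continuous_norm)
  rw [hnorm] at hk
  set κ := ∫ v : Plane, |v 0| ∂μ with hκ
  have hκ0 : 0 ≤ κ := integral_nonneg fun v => abs_nonneg _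
  -- Here `κ = 2 * (501/502) / π`. Lower bounds on `κ` suffice, since every tangent bound decreases
  -- in the moment it contains.
  have hκ1 : 0.635 ≤ κ := by
    have := mul_le_mul_of_nonneg_right Real.pi_lt_d4.le hκ0
    norm_num at this hk ⊢
    linarith
  have hH : 1.414 * 0.635 ≤ √2 * κ := by
    have h2 : (1.414 : ℝ) ≤ √2 := Real.le_sqrt_of_sq_le (by norm_num)
    exact mul_le_mul h2 hκ1 (by norm_num) (by positivity)
  have e0 := integral_serviceBound_zero_le hμ hint
  have e1 := integral_serviceBound_one hint (μ := μ)
  have e : ∀ i : Fin 7, i ≠ 0 → i ≠ 1 → _ := fun i => integral_serviceBound_of_ne hμ hint (i := i)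
  have n2 : ‖offset 2‖ ^ 2 = 36 / 625 := by rw [Plane.norm_sq]; simp [offset]; norm_num
  have n3 : ‖offset 3‖ ^ 2 = 36 / 625 := by rw [Plane.norm_sq]; simp [offset]; norm_num
  have n4 : ‖offset 4‖ ^ 2 = 36 / 625 := by rw [Plane.norm_sq]; simp [offset]; norm_num
  have n5 : ‖offset 5‖ ^ 2 = 0 := by rw [Plane.norm_sq]; simp [offset]
  have n6 : ‖offset 6‖ ^ 2 = 0 := by rw [Plane.norm_sq]; simp [offset]
  have hsub : ∀ i, ∫ v, (serviceBound i v - ‖v‖) ∂μ = ∫ v, serviceBound i v ∂μ - 501 / 502 := by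
    intro i
    rw [integral_sub (hint _ (continuous_serviceBound i)) (hint _ continuous_norm), hnorm]
  simp_rw [hsub]
  rw [Fin.sum_univ_seven, e1, e 2 (by decide) (by decide), e 3 (by decide) (by decide),
    e 4 (by decide) (by decide), e 5 (by decide) (by decide), e 6 (by decide) (by decide),
    n2, n3, n4, n5, n6]
  unfold tangentBound at *
  norm_num at *
  linarith

end SBM

/-! ### Transfer to the random sample -/

theorem mainTheorem8 :
    ∃ (μ : Measure (EuclideanSpace ℝ (Fin 2))) (c : Fin 7 → EuclideanSpace ℝ (Fin 2)),
      SBM.IsUnitBallProbability μ ∧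
      SBM.HasContinuousDensity μ ∧
      SBM.IsRotationInvariant μ ∧
      SBM.HasMassNearCenter μ ∧
      IsLeast {t : ℝ | ∃ i j : Fin 7, i ≠ j ∧ t = dist (c i) (c j)} (2.2 : ℝ) ∧
      SBM.WithHighProbability (fun n => SBM.sampleLaw μ 7 n)
        (fun n => {v : Fin 7 × Fin n → EuclideanSpace ℝ (Fin 2) |
          ¬ KMedian.AchievesExactRecovery (SBM.dataPoints c v)}) := by
  open SBM in
  set μ := radialMeasure 1000 with hμdef
  have hμ : IsRotationInvariant μ := isRotationInvariant_radialMeasure _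
  refine ⟨μ, gridCenter, isUnitBallProbability_radialMeasure _,
    hasContinuousDensity_radialMeasure _, hμ, hasMassNearCenter_radialMeasure _,
    isLeast_dist_gridCenter, ?_⟩
  -- Tolerance budget per ball and per point: `1/1000` for the mean cost, `2/1000` for the two
  -- directions, `1/1000` for moving medians to sample points. Over seven balls this is `28/1000`,
  -- below the gap `1/20`.
  have hcost : ∀ i : Fin 7, WithHighProbability (fun n => sampleLaw μ 7 n) _ := fun i =>
    whp_abs_sum_sub_lt (μ := μ) (F := fun v => serviceBound i v - ‖v‖)
      ((continuous_serviceBound i).sub continuous_norm).measurable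
      (memLp_radialMeasure_of_continuous _ ((continuous_serviceBound i).sub continuous_norm)) i
      (ε := 1 / 1000) (by norm_num)
  have hdir : ∀ r : Fin 7 × Fin 2, WithHighProbability (fun n => sampleLaw μ 7 n) _ := fun r =>
    whp_abs_sum_sub_lt (measurable_direction r.2)
      (MemLp.of_bound (measurable_direction r.2).aestronglyMeasurable 1
        (Filter.Eventually.of_forall (abs_direction_le r.2))) r.1 (ε := 1 / 1000) (by norm_num)
  have hmedian : ∀ j : Fin 7, WithHighProbability (fun n => sampleLaw μ 7 n) _ := fun j =>
    whp_exists_mem (U := Metric.ball (offset j) (1 / 1000)) Metric.isOpen_ball.measurableSet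
      (radialMeasure_pos_of_isOpen 1000 Metric.isOpen_ball
        ⟨offset j, by simp, by simpa using norm_offset_lt_one j⟩) (home j)
  have hnorm := whp_forall_of_ae (μ := μ) (k := 7)
    (p := fun x => ‖x‖ ≤ 1) (measurableSet_le measurable_norm measurable_const)
    (ae_norm_le_one 1000)
  refine ((WithHighProbability.iInter hcost).inter ((WithHighProbability.iInter hdir).inter
    ((WithHighProbability.iInter hmedian).inter hnorm))).mono ⟨0, fun n hn v hv hrec => ?_⟩
  obtain ⟨h1, h2, h3, h4⟩ := hv
  simp only [Set.mem_iInter, Set.mem_ofPred_eq] at h1 h2 h3 h4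
  choose l hl using h3
  have hP : Function.Injective fun j => (home j, l j) := by
    intro j j' hjj
    rw [Prod.mk.injEq] at hjj
    obtain ⟨ha, hb⟩ := hjj
    -- Only medians `0` and `1` share a ball. Their offsets are `8/5` apart, so one sample point
    -- cannot be close to both.
    have hlt : dist (offset j) (offset j') < 1 / 500 := by
      have e1 := hl j
      have e2 := hl j'
      rw [← ha, ← hb, Metric.mem_ball] at e2
      rw [Metric.mem_ball, dist_comm] at e1
      linarith [dist_triangle (offset j) (v (home j, l j)) (offset j')]
    have hcoord : |offset j 0 - offset j' 0| < 1 / 500 := by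
      refine lt_of_le_of_lt ?_ hlt
      rw [dist_eq_norm]
      exact PiLp.norm_apply_le (offset j - offset j') 0
    fin_cases j <;> fin_cases j' <;> first
      | rfl
      | exact absurd ha (by decide)
      | (exfalso; norm_num [offset] at hcoord)
  choose σ hσ using fun q : Fin 7 × Fin n => exists_dist_le_serviceBound q.1 (h4 q)
  obtain ⟨p, hp, hle⟩ := hrec.exists_centers hn hP σ
  have hupper : ∑ q : Fin 7 × Fin n,
      dist (dataPoints gridCenter v (home (σ q), l (σ q))) (dataPoints gridCenter v q)
      ≤ ∑ q : Fin 7 × Fin n, (serviceBound q.1 (v q) + 1 / 1000) := by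
    refine Finset.sum_le_sum fun q _ => ?_
    have e1 := hσ q
    have e2 := hl (σ q)
    rw [Metric.mem_ball] at e2
    have e3 := dist_triangle (dataPoints gridCenter v (home (σ q), l (σ q)))
      (gridCenter (home (σ q)) + offset (σ q)) (dataPoints gridCenter v q)
    simp only [dataPoints, dist_add_left] at e3 ⊢
    linarith
  -- The centers `p i` depend on the sample, which is harmless because the lower bound holds for
  -- every center in the ball at once.
  have hlower : ∑ i, (∑ l, ‖v (i, l)‖ - n * (1 / 500))
      ≤ ∑ q : Fin 7 × Fin n,
        dist (dataPoints gridCenter v (p q.1)) (dataPoints gridCenter v q) := by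
    rw [Fintype.sum_prod_type]
    refine Finset.sum_le_sum fun i _ => ?_
    have e1 := sum_norm_sub_le_sum_dist (fun l => v (i, l)) (h4 (p i))
    have e2 : ∀ r : Fin 2, |∑ l, direction r (v (i, l))| < n * (1 / 1000) := by
      intro r
      have := h2 (i, r)
      rwa [integral_coord_eq_zero hμ (direction_neg r), mul_zero, sub_zero] at this
    simp only [dataPoints, hp i, dist_eq_norm, add_sub_add_left_eq_sub]
    linarith [e2 0, e2 1]
  have hmid : ∑ i, (∑ l, serviceBound i (v (i, l)) - ∑ l, ‖v (i, l)‖)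
      ≤ ∑ i, (n * ∫ x, (serviceBound i x - ‖x‖) ∂μ + n * (1 / 1000)) := by
    refine Finset.sum_le_sum fun i _ => ?_
    have := (abs_lt.1 (h1 i)).2
    rw [Finset.sum_sub_distrib] at this
    linarith
  have hmean := sum_integral_serviceBound_lt
  rw [← hμdef] at hmean
  have hn' : (0 : ℝ) < n := by exact_mod_cast hn
  rw [Finset.sum_add_distrib, ← Finset.mul_sum, Finset.sum_sub_distrib] at hmid
  rw [Finset.sum_sub_distrib] at hlower
  rw [Finset.sum_add_distrib, Fintype.sum_prod_type fun q : Fin 7 × Fin n => serviceBound q.1 (v q)]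
    at hupper
  simp only [Finset.sum_const, Finset.card_univ, Fintype.card_prod, Fintype.card_fin,
    nsmul_eq_mul, Nat.cast_mul, Nat.cast_ofNat] at hmid hlower hupper
  have := mul_lt_mul_of_pos_left hmean hn'
  linarith
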